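/- Let $\sigma^2>0$ and $\alpha_1>1/2$ be fixed (and possibly known to the statistician). For each $n\ge 1$ let $\{\phi_1,\dots,\phi_n\}$ be a given orthonormal basis of $\mathbb{R}^n$ (the case $p_n=n$; the dependence of the basis on $n$ is suppressed), and observe $\mathbf y=\mathbf f+\boldsymbol\epsilon\in\mathbb{R}^n$ with $\epsilon_1,\dots,\epsilon_n$ i.i.d. $N(0,\sigma^2)$. Put $\theta_j=\theta_j(\mathbf f)=\phi_j^\top\mathbf f/\sqrt n$. For an estimator $\hat{\mathbf f}$, i.e. a measurable function of $\mathbf y$, let $R_n(\hat{\mathbf f},\mathbf f)=n^{-1}\mathbb{E}\|\hat{\mathbf f}-\mathbf f\|^2\in[0,\infty]$. For $I\subseteq\{1,\dots,n\}$ let $\hat{\mathbf f}_I$ be the orthogonal projection of $\mathbf y$ onto the span of $\{\phi_j:j\in I\}$, and let $$R_n(\mathbf w^*|\mathcal M_{AS},\mathbf f)=\min_{\mathbf w}R_n\Bigl(\sum_{I}w_I\hat{\mathbf f}_I,\mathbf f\Bigr)$$ be the ideal model averaging risk, where the sum runs over all $2^n$ subsets $I\subseteq\{1,\dots,n\}$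 and the minimum over all weights $w_I\ge 0$ with $\sum_I w_I=1$. Then for every sequence of estimators $\hat{\mathbf f}=\hat{\mathbf f}_n$ there is a sequence of mean vectors $\mathbf f=\mathbf f_n\in\mathbb{R}^n$ such that for each $n$ the coefficient vector $(\theta_1,\dots,\theta_n)$ is a permutation of $(1^{-\alpha_1},2^{-\alpha_1},\dots,n^{-\alpha_1})$ (in particular $\limsup_n n^{-1}\|\mathbf f_n\|^2<\infty$), and $$\lim_{n\to\infty}\frac{R_n(\hat{\mathbf f},\mathbf f)}{R_n(\mathbf w^*|\mathcal M_{AS},\mathbf f)}=\infty .$$ In particular, $\hat{\mathbf f}$ does not satisfy $R_n(\hat{\mathbf f},\mathbf f)\le[1+o(1)]\,R_n(\mathbf w^*|\mathcal M_{AS},\mathbf f)$ at this $\mathbf f$, i.e. it does not achieve the ideal asymptotic optimality (AOP) there. -/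

import Mathlib

open MeasureTheory ProbabilityTheory Filter Topology
open scoped NNReal ENNReal

noncomputable section

namespace ModelAveraging

/-- The sample space `ℝⁿ` with its Euclidean norm. -/
abbrev Obs (n : ℕ) : Type := EuclideanSpace ℝ (Fin n)

/-- The law of the error vector `(ε₁, …, εₙ)` with `εᵢ` i.i.d. `N(0, v)`, where `v = σ²`. -/
def noiseLaw (n : ℕ) (v : ℝ≥0) : Measure (Obs n) :=
  (Measure.pi fun _ : Fin n => gaussianReal 0 v).map (WithLp.toLp 2)

/-- The normalized squared loss `n⁻¹ ‖g - f‖²`. -/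
def loss {n : ℕ} (g f : Obs n) : ℝ := ‖g - f‖ ^ 2 / n

/-- The risk `E n⁻¹ ‖fhat(y) - f‖²` of an estimator `fhat` (a function of the data `y = f + ε`).
It is an extended nonnegative number: it is `∞` when the loss has no finite expectation. -/
def risk {n : ℕ} (v : ℝ≥0) (fhat : Obs n → Obs n) (f : Obs n) : ℝ≥0∞ :=
  ∫⁻ ε, ENNReal.ofReal (loss (fhat (f + ε)) f) ∂(noiseLaw n v)

/-- The transformed coefficients `θⱼ(f) = ⟨φⱼ, f⟩ / √n`. -/
def coeff {n : ℕ} (φ : OrthonormalBasis (Fin n) ℝ (Obs n)) (f : Obs n) (j : Fin n) : ℝ :=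
  inner ℝ (φ j) f / √(n : ℝ)

/-- The least squares estimator in the candidate model with regressors `φⱼ`, `j ∈ I`: the
orthogonal projection of the data onto the span of these regressors. -/
def lsEstimator {n : ℕ} (φ : OrthonormalBasis (Fin n) ℝ (Obs n)) (I : Finset (Fin n)) :
    Obs n → Obs n :=
  fun y => (Submodule.span ℝ (φ '' (I : Set (Fin n)))).starProjection y

/-- The model averaging estimator `∑_I w_I fhat_I` over all subsets `I` of the regressors. -/
def maEstimator {n : ℕ} (φ : OrthonormalBasis (Fin n) ℝ (Obs n)) (w : Finset (Fin n) → ℝ) :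
    Obs n → Obs n :=
  fun y => ∑ I : Finset (Fin n), w I • lsEstimator φ I y

/-- The ideal model averaging risk: the least risk of the averages of all subset models over
all weight vectors (nonnegative, with sum one). -/
def idealMARisk {n : ℕ} (v : ℝ≥0) (φ : OrthonormalBasis (Fin n) ℝ (Obs n)) (f : Obs n) : ℝ≥0∞ :=
  ⨅ w ∈ stdSimplex ℝ (Finset (Fin n)), risk v (maEstimator φ w) f

/-- The set of all vectors whose entries are a permutation of the entries of `e`. -/
def rearrangements {n : ℕ} (e : Fin n → ℝ) : Set (Fin n → ℝ) :=
  {θ | ∃ π : Equiv.Perm (Fin n), ∀ j, θ j = e (π j)}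

/-- The vector `(1^{-α}, 2^{-α}, …, n^{-α})`. -/
def polyDecay (n : ℕ) (α : ℝ) : Fin n → ℝ := fun j => ((j : ℕ) + 1 : ℝ) ^ (-α)

/-- The sequence of estimators `fhat` achieves the ideal asymptotic optimality at `f`:
its risk is at most `(1 + o(1))` times the ideal model averaging risk. -/
def AchievesIdealAOP (v : ℝ≥0) (φ : ∀ n : ℕ, OrthonormalBasis (Fin n) ℝ (Obs n))
    (fhat : ∀ n : ℕ, Obs n → Obs n) (f : ∀ n : ℕ, Obs n) : Prop :=
  ∃ δ : ℕ → ℝ≥0∞, Tendsto δ atTop (𝓝 0) ∧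
    ∀ᶠ n in atTop, risk v (fhat n) (f n) ≤ (1 + δ n) * idealMARisk v (φ n) (f n)

end ModelAveraging

end

namespace ModelAveraging

/-! Knowing where the large coefficients sit, one projects onto the `⌈n ^ (1/(2α))⌉` largest of them
and has risk of order `n ^ (1/(2α) - 1)`, which bounds the ideal risk (`idealMARisk_polyDecay_le`).
An estimator must find these positions, and for coefficients of the size of the noise level it
cannot.

Let `G` be the about `m ≈ ε n ^ (1/(2α))` entries with ranks between `m` and `2m`, of order `ε ^
(-α) / √n`, and `L` the smaller half of all entries. Exchanging an entry of `G` with one of `L`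
moves the mean vector by a squared distance bounded independently of `n`, so probabilities under the
two means are comparable up to a fixed factor `T` and an additive `1/2` (`noiseLaw_shift_le`). Thus
a coordinate holding an entry of `G` is missed, or the same coordinate gives a false alarm when it
holds an entry of `L`. Since `T * |G| ≤ |L|` for large `n`, the false alarms add up to as much as
the misses would. Averaging over all permutations (`exists_perm_le_risk`) yields risk at least `|G|
d² / 8`, with `d` the gap between the two groups. This is a multiple of `ε ^ (1 - 2α) * n ^ (1/(2α)
- 1)`; since `1 - 2α < 0`, a small `ε` makes the factor arbitrarily large. -/

/-! ### Gaussian shifts and likelihood ratios -/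

theorem pi_withDensity {ι : Type*} [Fintype ι] {Ω : ι → Type*} [∀ i, MeasurableSpace (Ω i)]
    (μ : ∀ i, Measure (Ω i)) [∀ i, IsProbabilityMeasure (μ i)] (g : ∀ i, Ω i → ℝ≥0∞)
    (hg : ∀ i, Measurable (g i)) [∀ i, SigmaFinite ((μ i).withDensity (g i))] :
    Measure.pi (fun i => (μ i).withDensity (g i)) =
      (Measure.pi μ).withDensity (fun x => ∏ i, g i (x i)) := by
  refine Measure.pi_eq fun s hs => ?_
  rw [withDensity_apply _ (MeasurableSet.univ_pi hs), ← lintegral_indicator (MeasurableSet.univ_pi hs)]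
  have h1 : (Set.univ.pi s).indicator (fun x => ∏ i, g i (x i)) =
      fun x => ∏ i, (s i).indicator (g i) (x i) := by
    classical
    funext x
    by_cases hx : x ∈ Set.univ.pi s
    · rw [Set.indicator_of_mem hx]
      refine Finset.prod_congr rfl fun i _ => ?_
      rw [Set.indicator_of_mem (hx i (Set.mem_univ i))]
    · rw [Set.indicator_of_notMem hx]
      simp only [Set.mem_univ_pi, not_forall] at hx
      obtain ⟨i, hi⟩ := hx
      exact (Finset.prod_eq_zero (Finset.mem_univ i) (Set.indicator_of_notMem hi _)).symm
  have hm : ∀ i, Measurable ((s i).indicator (g i)) := fun i => (hg i).indicator (hs i)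
  have hind : iIndepFun (fun i (x : ∀ i, Ω i) => (s i).indicator (g i) (x i)) (Measure.pi μ) :=
    iIndepFun_pi (fun i => (hm i).aemeasurable)
  rw [h1, lintegral_prod_eq_prod_lintegral_of_indepFun _ _ hind
    (fun i => (hm i).comp (measurable_pi_apply i))]
  refine Finset.prod_congr rfl fun i _ => ?_
  rw [withDensity_apply _ (hs i), ← lintegral_indicator (hs i)]
  exact (measurePreserving_eval μ i).lintegral_comp (hm i)

theorem gaussianReal_eq_withDensity {v : ℝ≥0} (hv : v ≠ 0) (u : ℝ) :
    gaussianReal u v = (gaussianReal 0 v).withDensity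
      (fun x => ENNReal.ofReal (Real.exp ((u * x - u ^ 2 / 2) / v))) := by
  rw [gaussianReal_of_var_ne_zero _ hv, gaussianReal_of_var_ne_zero _ hv, ← withDensity_mul _
    (measurable_gaussianPDF _ _) (by fun_prop)]
  congr 1
  funext x
  have hv' : (v : ℝ) ≠ 0 := by exact_mod_cast hv
  rw [Pi.mul_apply, gaussianPDF, gaussianPDF, ← ENNReal.ofReal_mul (gaussianPDFReal_nonneg _ _ _),
    gaussianPDFReal, gaussianPDFReal, mul_assoc (√_)⁻¹ (Real.exp _), ← Real.exp_add]
  congr 3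
  field_simp
  ring

variable {n : ℕ} {v : ℝ≥0}

instance isProbabilityMeasure_noiseLaw : IsProbabilityMeasure (noiseLaw n v) :=
  Measure.isProbabilityMeasure_map (by fun_prop)

/-- Cameron–Martin formula in finite dimension: the one-dimensional likelihood ratios multiply over
the independent coordinates. -/
theorem noiseLaw_map_add (hv : v ≠ 0) (u : Obs n) :
    (noiseLaw n v).map (fun x => u + x) = (noiseLaw n v).withDensity
      (fun x => ENNReal.ofReal (Real.exp ((inner ℝ u x - ‖u‖ ^ 2 / 2) / v))) := by
  have hpi : (Measure.pi fun _ : Fin n => gaussianReal 0 v).map (fun x i => u i + x i) =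
      (Measure.pi fun _ : Fin n => gaussianReal 0 v).withDensity
        (fun x => ∏ i, ENNReal.ofReal (Real.exp ((u i * x i - u i ^ 2 / 2) / v))) := by
    have hs : ∀ i, SigmaFinite ((gaussianReal 0 v).withDensity
      (fun x => ENNReal.ofReal (Real.exp ((u i * x - u i ^ 2 / 2) / v)))) := fun i => by
      rw [← gaussianReal_eq_withDensity hv]; infer_instance
    rw [← pi_withDensity (fun _ : Fin n => gaussianReal 0 v)
      (fun i x => ENNReal.ofReal (Real.exp ((u i * x - u i ^ 2 / 2) / v))) (fun i => by fun_prop)]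
    simp_rw [← gaussianReal_eq_withDensity hv]
    have hs : ∀ i, SigmaFinite ((gaussianReal 0 v).map (fun x => u i + x)) := fun i => by
      rw [gaussianReal_map_const_add]; infer_instance
    rw [Measure.pi_map_pi (f := fun i x => u i + x) (fun i => by fun_prop)]
    simp_rw [gaussianReal_map_const_add, zero_add]
  rw [noiseLaw, Measure.map_map (by fun_prop) (by fun_prop)]
  have h2 : ((fun x => u + x) ∘ (WithLp.toLp 2 : (Fin n → ℝ) → Obs n)) =
      (WithLp.toLp 2) ∘ (fun x i => u i + x i) := by
    funext x; ext i; simp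
  rw [h2, ← Measure.map_map (by fun_prop) (by fun_prop), hpi]
  ext s hs
  rw [Measure.map_apply (by fun_prop) hs, withDensity_apply _ hs, withDensity_apply _
    ((by fun_prop : Measurable (WithLp.toLp 2 : (Fin n → ℝ) → Obs n)) hs),
    setLIntegral_map hs (by fun_prop) (by fun_prop)]
  refine lintegral_congr fun x => ?_
  rw [← ENNReal.ofReal_prod_of_nonneg (fun _ _ => (Real.exp_pos _).le), ← Real.exp_sum,
    ← Finset.sum_div, Finset.sum_sub_distrib, EuclideanSpace.norm_sq_eq, PiLp.inner_apply]
  congr 5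
  · funext i; simp [mul_comm]
  · rw [Finset.sum_div]; simp

theorem lintegral_exp_inner_noiseLaw (hv : v ≠ 0) (u : Obs n) :
    ∫⁻ x, ENNReal.ofReal (Real.exp ((inner ℝ u x - ‖u‖ ^ 2 / 2) / v)) ∂(noiseLaw n v) = 1 := by
  have h := congrArg (fun μ => μ Set.univ) (noiseLaw_map_add hv u)
  simp only [withDensity_apply _ MeasurableSet.univ, Measure.restrict_univ] at h
  rw [← h, Measure.map_apply (by fun_prop) MeasurableSet.univ]
  simp

/-! ### Two-point testing bound -/

/-- The factor by which Gaussian shift experiments at squared distance `D` are compared. -/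
noncomputable def shiftFactor (v : ℝ≥0) (D : ℝ) : ℝ := 2 * Real.exp (D / v)

theorem shiftFactor_pos (D : ℝ) : 0 < shiftFactor v D := by unfold shiftFactor; positivity

/-- Probabilities of events about the data at two mean vectors are comparable. -/
theorem noiseLaw_shift_le (hv : v ≠ 0) (f g : Obs n) {D : ℝ} (hD : ‖f - g‖ ^ 2 ≤ D)
    {S : Set (Obs n)} (hS : MeasurableSet S) :
    noiseLaw n v ((fun x => f + x) ⁻¹' S) ≤
      ENNReal.ofReal (shiftFactor v D) * noiseLaw n v ((fun x => g + x) ⁻¹' S) + 2⁻¹ := by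
  set u := f - g with hu
  set T := shiftFactor v D with hT
  have hT0 : 0 < T := shiftFactor_pos D
  set S' := (fun x => g + x) ⁻¹' S
  have hS' : MeasurableSet S' := (by fun_prop : Measurable (fun x : Obs n => g + x)) hS
  have h1 : (fun x => f + x) ⁻¹' S = (fun x => u + x) ⁻¹' S' := by
    ext x; simp [S', hu, ← add_assoc]
  rw [h1, ← Measure.map_apply (by fun_prop) hS', noiseLaw_map_add hv, withDensity_apply _ hS']
  set r : Obs n → ℝ := fun x => Real.exp ((inner ℝ u x - ‖u‖ ^ 2 / 2) / v) with hr
  have hv' : (v : ℝ) ≠ 0 := by exact_mod_cast hv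
  have hv0 : (0 : ℝ) < v := by positivity
  have hrm : Measurable r := by fun_prop
  have hr0 : ∀ x, 0 < r x := fun x => Real.exp_pos _
  -- Truncation of the likelihood ratio at `T`: where `r > T`, it is at most `r² / T`.
  have hpt : ∀ x, ENNReal.ofReal (r x) ≤ ENNReal.ofReal T + ENNReal.ofReal (r x ^ 2 / T) := by
    intro x
    rw [← ENNReal.ofReal_add hT0.le (by positivity)]
    apply ENNReal.ofReal_le_ofReal
    rw [← sub_nonneg]
    have : T + r x ^ 2 / T - r x = ((T - r x) ^ 2 + T * r x) / T := by field_simp; ring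
    rw [this]
    have := hr0 x
    positivity
  -- `r²` is `exp (‖u‖² / v)` times the likelihood ratio of the shift by `2u`, so its integral is
  -- `exp (‖u‖² / v)`. The factor 2 in `shiftFactor` turns the remainder into `1/2`.
  have hsq : ∀ x, ENNReal.ofReal (r x ^ 2 / T) = ENNReal.ofReal (Real.exp (‖u‖ ^ 2 / v) / T) *
      ENNReal.ofReal (Real.exp ((inner ℝ ((2 : ℝ) • u) x - ‖(2 : ℝ) • u‖ ^ 2 / 2) / v)) := by
    intro x
    rw [← ENNReal.ofReal_mul (by positivity), div_mul_eq_mul_div, ← Real.exp_add, hr]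
    simp only
    rw [← Real.exp_nat_mul, inner_smul_left, norm_smul]
    congr 3
    simp
    field_simp
    ring
  calc ∫⁻ x in S', ENNReal.ofReal (r x) ∂(noiseLaw n v)
      ≤ ∫⁻ x in S', (ENNReal.ofReal T + ENNReal.ofReal (r x ^ 2 / T)) ∂(noiseLaw n v) :=
        lintegral_mono hpt
    _ = ENNReal.ofReal T * noiseLaw n v S' +
        ∫⁻ x in S', ENNReal.ofReal (r x ^ 2 / T) ∂(noiseLaw n v) := by
        rw [lintegral_add_left measurable_const, setLIntegral_const]
    _ ≤ ENNReal.ofReal T * noiseLaw n v S' +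
        ∫⁻ x, ENNReal.ofReal (r x ^ 2 / T) ∂(noiseLaw n v) := by
        gcongr; exact Measure.restrict_le_self
    _ ≤ _ := by
        gcongr
        simp_rw [hsq]
        rw [lintegral_const_mul _ (by fun_prop), lintegral_exp_inner_noiseLaw hv, mul_one,
          show (2⁻¹ : ℝ≥0∞) = ENNReal.ofReal 2⁻¹ by
            rw [ENNReal.ofReal_inv_of_pos two_pos]; simp]
        apply ENNReal.ofReal_le_ofReal
        rw [div_le_iff₀ hT0, hT, shiftFactor, ← mul_assoc, inv_mul_cancel₀ two_ne_zero, one_mul]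
        gcongr

/-- Two point lower bound: a statistic cannot be close to `a` at the mean vector `f` and, with a
large weight on that error, close to `b` at the mean vector `g`. -/
theorem two_point_lower_bound (hv : v ≠ 0) (f g : Obs n) {D : ℝ} (hD : ‖f - g‖ ^ 2 ≤ D)
    {h : Obs n → ℝ} (hh : Measurable h) {a b d : ℝ} (hd : 0 ≤ d) (hab : d ≤ |a - b|)
    {m l : ℕ} (hml : shiftFactor v D * m ≤ l) :
    m * ENNReal.ofReal (d ^ 2 / 8) ≤
      m * ∫⁻ x, ENNReal.ofReal ((h (f + x) - a) ^ 2) ∂(noiseLaw n v) +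
      l * ∫⁻ x, ENNReal.ofReal ((h (g + x) - b) ^ 2) ∂(noiseLaw n v) := by
  -- Test by distance to `a`: on `B` the error at `f` is at least `d / 2`, and off `B` the triangle
  -- inequality gives the same for the error at `g`.
  set B : Set (Obs n) := {y | d / 2 ≤ |h y - a|} with hB
  have hBm : MeasurableSet B := measurableSet_le measurable_const (by fun_prop)
  have hmf : Measurable (fun x : Obs n => f + x) := by fun_prop
  have hmg : Measurable (fun x : Obs n => g + x) := by fun_prop
  have key : ∀ (S : Set (Obs n)) (c : ℝ) (e : Obs n), MeasurableSet S →
      (∀ y ∈ S, d / 2 ≤ |h y - c|) →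
      ENNReal.ofReal (d ^ 2 / 4) * noiseLaw n v ((fun x => e + x) ⁻¹' S) ≤
        ∫⁻ x, ENNReal.ofReal ((h (e + x) - c) ^ 2) ∂(noiseLaw n v) := by
    intro S c e hS hc
    have hme : Measurable (fun x : Obs n => e + x) := by fun_prop
    rw [← lintegral_indicator_const (hme hS)]
    refine lintegral_mono fun x => ?_
    by_cases hx : x ∈ (fun x => e + x) ⁻¹' S
    · rw [Set.indicator_of_mem hx]
      apply ENNReal.ofReal_le_ofReal
      have := hc _ hx
      rw [← sq_abs (h (e + x) - c)]
      nlinarith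
    · rw [Set.indicator_of_notMem hx]; exact bot_le
  have h1 := key B a f hBm (fun y hy => hy)
  have h2 := key Bᶜ b g hBm.compl (fun y hy => by
    have hy' : |h y - a| < d / 2 := not_le.mp hy
    have := abs_sub_le a (h y) b
    rw [abs_sub_comm a (h y)] at this
    linarith)
  have h3 := noiseLaw_shift_le hv f g hD hBm.compl
  have h4 : noiseLaw n v ((fun x => f + x) ⁻¹' B) + noiseLaw n v ((fun x => f + x) ⁻¹' Bᶜ) = 1 := by
    rw [Set.preimage_compl, measure_add_measure_compl (hmf hBm), measure_univ]
  set p := noiseLaw n v ((fun x => f + x) ⁻¹' B)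
  set q := noiseLaw n v ((fun x => f + x) ⁻¹' Bᶜ)
  set s := noiseLaw n v ((fun x => g + x) ⁻¹' Bᶜ)
  have h5 : ENNReal.ofReal (shiftFactor v D) * m ≤ l := by
    rw [← ENNReal.ofReal_natCast m, ← ENNReal.ofReal_natCast l,
      ← ENNReal.ofReal_mul (shiftFactor_pos D).le]
    exact ENNReal.ofReal_le_ofReal hml
  have h6 : (2⁻¹ : ℝ≥0∞) ≤ p + ENNReal.ofReal (shiftFactor v D) * s := by
    have h7 : (1 : ℝ≥0∞) ≤ (p + ENNReal.ofReal (shiftFactor v D) * s) + 2⁻¹ := by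
      rw [← h4, add_assoc]; gcongr
    rw [← ENNReal.inv_two_add_inv_two] at h7
    exact (ENNReal.add_le_add_iff_right (by simp)).1 h7
  calc m * ENNReal.ofReal (d ^ 2 / 8) = m * (ENNReal.ofReal (d ^ 2 / 4) * 2⁻¹) := by
        rw [show (2⁻¹ : ℝ≥0∞) = ENNReal.ofReal 2⁻¹ by
            rw [ENNReal.ofReal_inv_of_pos two_pos]; simp, ← ENNReal.ofReal_mul (by positivity)]
        congr 2; ring
    _ ≤ m * (ENNReal.ofReal (d ^ 2 / 4) * (p + ENNReal.ofReal (shiftFactor v D) * s)) := by gcongr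
    _ = m * (ENNReal.ofReal (d ^ 2 / 4) * p) +
        (ENNReal.ofReal (shiftFactor v D) * m) * (ENNReal.ofReal (d ^ 2 / 4) * s) := by ring
    _ ≤ _ := by gcongr

/-! ### Risk of a single subset model -/

theorem memLp_eval_pi_gaussianReal (i : Fin n) :
    MemLp (fun x : Fin n → ℝ => x i) 2 (Measure.pi fun _ : Fin n => gaussianReal 0 v) :=
  (memLp_id_gaussianReal (μ := 0) (v := v) 2).comp_measurePreserving
    (measurePreserving_eval (fun _ : Fin n => gaussianReal 0 v) i)

theorem lintegral_inner_sq_noiseLaw (u : Obs n) :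
    ∫⁻ x, ENNReal.ofReal (inner ℝ u x ^ 2) ∂(noiseLaw n v) = ENNReal.ofReal (‖u‖ ^ 2 * v) := by
  rw [noiseLaw, lintegral_map (by fun_prop) (by fun_prop)]
  set P := Measure.pi fun _ : Fin n => gaussianReal 0 v
  have hL : ∀ i, MemLp (fun x : Fin n → ℝ => u i * x i) 2 P :=
    fun i => (memLp_eval_pi_gaussianReal i).const_mul (u i)
  have hsum : MemLp (∑ i, fun x : Fin n → ℝ => u i * x i) 2 P :=
    memLp_finsetSum' _ fun i _ => hL i
  have hvar : Var[∑ i, fun x : Fin n → ℝ => u i * x i; P] = ‖u‖ ^ 2 * v := by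
    have := variance_sum_pi (μ := fun _ : Fin n => gaussianReal 0 v)
      (X := fun i (t : ℝ) => u i * t) (fun i => (memLp_id_gaussianReal 2).const_mul (u i))
    rw [this, EuclideanSpace.norm_sq_eq, Finset.sum_mul]
    refine Finset.sum_congr rfl fun i _ => ?_
    have h1 := variance_id_gaussianReal (μ := 0) (v := v)
    rw [variance_const_mul (u i) (fun t => t)]
    change _ * Var[id; _] = _
    rw [h1]; simp
  have hmean : ∫ x, (∑ i, fun x : Fin n → ℝ => u i * x i) x ∂P = 0 := by
    simp only [Finset.sum_apply]
    rw [integral_finsetSum _ fun i _ => (hL i).integrable one_le_two]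
    refine Finset.sum_eq_zero fun i _ => ?_
    have h2 : ∫ x : Fin n → ℝ, x i ∂P = 0 := by
      have h3 := integral_map (μ := P) (φ := Function.eval i) (f := fun t : ℝ => t)
        (measurable_pi_apply i).aemeasurable (by fun_prop)
      rw [(measurePreserving_eval (fun _ : Fin n => gaussianReal 0 v) i).map_eq,
        integral_id_gaussianReal] at h3
      exact h3.symm
    rw [integral_const_mul, h2, mul_zero]
  rw [← hvar, hsum.ofReal_variance_eq, evariance_eq_lintegral_ofReal, hmean]
  refine lintegral_congr fun x => ?_
  rw [PiLp.inner_apply, Finset.sum_apply, sub_zero]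
  simp [mul_comm]

theorem loss_eq_sum (φ : OrthonormalBasis (Fin n) ℝ (Obs n)) (g f : Obs n) :
    loss g f = ∑ j, (inner ℝ (φ j) g / √(n : ℝ) - coeff φ f j) ^ 2 := by
  rw [loss, ← φ.sum_sq_norm_inner_right, Finset.sum_div]
  refine Finset.sum_congr rfl fun j _ => ?_
  rw [coeff, ← sub_div, div_pow, Real.sq_sqrt (Nat.cast_nonneg n), inner_sub_right,
    Real.norm_eq_abs, sq_abs]

theorem inner_lsEstimator (φ : OrthonormalBasis (Fin n) ℝ (Obs n)) (I : Finset (Fin n))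
    (y : Obs n) (j : Fin n) :
    inner ℝ (φ j) (lsEstimator φ I y) = if j ∈ I then inner ℝ (φ j) y else 0 := by
  rw [lsEstimator, ← Submodule.inner_starProjection_left_eq_right]
  split_ifs with hj
  · rw [Submodule.starProjection_eq_self_iff.2]
    exact Submodule.subset_span ⟨j, by simpa using hj, rfl⟩
  · rw [(Submodule.starProjection_apply_eq_zero_iff _).2, inner_zero_left]
    rw [Submodule.mem_orthogonal]
    intro z hz
    induction hz using Submodule.span_induction with
    | mem z hz =>
      obtain ⟨i, hi, rfl⟩ := hz
      exact φ.orthonormal.2 (fun h => hj (by simpa [h] using hi))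
    | zero => simp
    | add a b _ _ ha hb => rw [inner_add_left, ha, hb, add_zero]
    | smul c a _ ha => rw [inner_smul_left, ha, mul_zero]

theorem maEstimator_single (φ : OrthonormalBasis (Fin n) ℝ (Obs n)) (I : Finset (Fin n)) :
    maEstimator φ (Pi.single I 1) = lsEstimator φ I := by
  funext y
  rw [maEstimator, Finset.sum_eq_single I]
  · simp
  · intro J _ hJ; simp [Pi.single_eq_of_ne hJ]
  · simp

/-- Weights concentrated on one model `I` are admissible; its risk is variance `v / n` per fitted
coordinate plus the squared bias of the omitted ones. -/
theorem idealMARisk_le (φ : OrthonormalBasis (Fin n) ℝ (Obs n)) (f : Obs n)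
    (I : Finset (Fin n)) :
    idealMARisk v φ f ≤ ENNReal.ofReal (I.card * v / n + ∑ j ∈ Iᶜ, coeff φ f j ^ 2) := by
  refine (iInf₂_le _ (single_mem_stdSimplex ℝ I)).trans (le_of_eq ?_)
  rw [maEstimator_single, risk]
  have hl : ∀ x, ENNReal.ofReal (loss (lsEstimator φ I (f + x)) f) =
      (∑ j ∈ I, ENNReal.ofReal ((1 / n : ℝ)) * ENNReal.ofReal (inner ℝ (φ j) x ^ 2)) +
        ENNReal.ofReal (∑ j ∈ Iᶜ, coeff φ f j ^ 2) := by
    intro x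
    simp_rw [← ENNReal.ofReal_mul (show (0 : ℝ) ≤ 1 / n by positivity)]
    rw [← ENNReal.ofReal_sum_of_nonneg (fun _ _ => by positivity), ← ENNReal.ofReal_add
      (Finset.sum_nonneg fun _ _ => by positivity) (Finset.sum_nonneg fun _ _ => by positivity),
      loss_eq_sum φ, ← Finset.sum_add_sum_compl I]
    congr 2
    · refine Finset.sum_congr rfl fun j hj => ?_
      rw [inner_lsEstimator, if_pos hj, coeff, ← sub_div, inner_add_right, add_sub_cancel_left,
        div_pow, Real.sq_sqrt (Nat.cast_nonneg n)]
      ring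
    · refine Finset.sum_congr rfl fun j hj => ?_
      rw [inner_lsEstimator, if_neg (Finset.mem_compl.1 hj)]
      ring
  simp_rw [hl]
  rw [lintegral_add_right _ measurable_const, lintegral_const, measure_univ, mul_one,
    lintegral_finsetSum _ (fun j _ => by fun_prop), ENNReal.ofReal_add (by positivity)
      (Finset.sum_nonneg fun _ _ => by positivity)]
  congr 1
  have : ∀ j ∈ I, ∫⁻ x, ENNReal.ofReal ((1 / n : ℝ)) * ENNReal.ofReal (inner ℝ (φ j) x ^ 2)
      ∂(noiseLaw n v) = ENNReal.ofReal (v / n) := by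
    intro j _
    rw [lintegral_const_mul _ (by fun_prop), lintegral_inner_sq_noiseLaw, φ.orthonormal.1 j,
      ← ENNReal.ofReal_mul (by positivity)]
    congr 1; ring
  rw [Finset.sum_congr rfl this, Finset.sum_const, nsmul_eq_mul, ← ENNReal.ofReal_natCast,
    ← ENNReal.ofReal_mul (by positivity), mul_div_assoc]

/-! ### Permuted coefficient vectors and the averaging argument -/

/-- The mean vector with given transformed coefficients. -/
noncomputable def meanVector (φ : OrthonormalBasis (Fin n) ℝ (Obs n)) (θ : Fin n → ℝ) : Obs n :=
  φ.repr.symm (WithLp.toLp 2 fun j => √(n : ℝ) * θ j)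

theorem coeff_meanVector (φ : OrthonormalBasis (Fin n) ℝ (Obs n)) (θ : Fin n → ℝ) (j : Fin n) :
    coeff φ (meanVector φ θ) j = θ j := by
  have hn : (0 : ℝ) < n := by exact_mod_cast j.pos
  rw [coeff, ← φ.repr_apply_apply, meanVector, LinearIsometryEquiv.apply_symm_apply]
  have := Real.sqrt_pos.2 hn
  field_simp

theorem norm_sq_meanVector_sub (φ : OrthonormalBasis (Fin n) ℝ (Obs n)) (θ θ' : Fin n → ℝ) :
    ‖meanVector φ θ - meanVector φ θ'‖ ^ 2 = n * ∑ j, (θ j - θ' j) ^ 2 := by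
  rw [meanVector, meanVector, ← map_sub, LinearIsometryEquiv.norm_map, EuclideanSpace.norm_sq_eq,
    Finset.mul_sum]
  refine Finset.sum_congr rfl fun j _ => ?_
  rw [← WithLp.toLp_sub, Real.norm_eq_abs, sq_abs]
  change (√(n : ℝ) * θ j - √(n : ℝ) * θ' j) ^ 2 = _
  rw [← mul_sub, mul_pow, Real.sq_sqrt (Nat.cast_nonneg n)]

theorem norm_sq_meanVector (φ : OrthonormalBasis (Fin n) ℝ (Obs n)) (θ : Fin n → ℝ) :
    ‖meanVector φ θ‖ ^ 2 = n * ∑ j, θ j ^ 2 := by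
  have h0 : meanVector φ (0 : Fin n → ℝ) = 0 := by
    rw [meanVector, LinearIsometryEquiv.map_eq_zero_iff]
    ext j; simp
  simpa [h0] using norm_sq_meanVector_sub φ θ 0

theorem sum_sq_sub_comp_swap {k l : Fin n} (hkl : k ≠ l) (e : Fin n → ℝ) (π : Equiv.Perm (Fin n)) :
    ∑ j, (e (π j) - e ((Equiv.swap k l * π) j)) ^ 2 = 2 * (e k - e l) ^ 2 := by
  have h : ∑ j, (e (π j) - e ((Equiv.swap k l * π) j)) ^ 2 =
      ∑ i, (e i - e (Equiv.swap k l i)) ^ 2 :=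
    Equiv.sum_comp π (fun i => (e i - e (Equiv.swap k l i)) ^ 2)
  rw [h, Fintype.sum_eq_add k l hkl]
  · simp only [Equiv.swap_apply_left, Equiv.swap_apply_right]; ring
  · rintro i ⟨hik, hil⟩
    rw [Equiv.swap_apply_of_ne_of_ne hik hil]; simp

/-- The contribution to the risk of the position at which the entry `e i` has been put. -/
noncomputable def rankRisk (v : ℝ≥0) (φ : OrthonormalBasis (Fin n) ℝ (Obs n))
    (fhat : Obs n → Obs n) (e : Fin n → ℝ) (π : Equiv.Perm (Fin n)) (i : Fin n) : ℝ≥0∞ :=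
  ∫⁻ x, ENNReal.ofReal ((inner ℝ (φ (π.symm i)) (fhat (meanVector φ (e ∘ π) + x)) / √(n : ℝ)
    - e i) ^ 2) ∂(noiseLaw n v)

theorem risk_meanVector_eq_sum (φ : OrthonormalBasis (Fin n) ℝ (Obs n))
    {fhat : Obs n → Obs n} (hf : Measurable fhat) (e : Fin n → ℝ) (π : Equiv.Perm (Fin n)) :
    risk v fhat (meanVector φ (e ∘ π)) = ∑ i, rankRisk v φ fhat e π i := by
  unfold rankRisk
  rw [← lintegral_finsetSum _ (fun i _ => by fun_prop), risk]
  refine lintegral_congr fun x => ?_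
  rw [loss_eq_sum φ, ENNReal.ofReal_sum_of_nonneg (fun _ _ => by positivity),
    ← Equiv.sum_comp π.symm]
  refine Finset.sum_congr rfl fun i _ => ?_
  rw [coeff_meanVector]; simp

/-- The position holding `e k` under `π` holds `e l` after the swap, so both errors concern the same
coordinate of the estimator and the two-point bound applies to it. -/
theorem rankRisk_swap_lower_bound (hv : v ≠ 0) (φ : OrthonormalBasis (Fin n) ℝ (Obs n))
    {fhat : Obs n → Obs n} (hf : Measurable fhat) (e : Fin n → ℝ) (π : Equiv.Perm (Fin n))
    {k l : Fin n} (hkl : k ≠ l) {d D : ℝ} (hd : 0 ≤ d) (hde : d ≤ |e k - e l|)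
    (hD : 2 * n * (e k - e l) ^ 2 ≤ D) {p q : ℕ} (hpq : shiftFactor v D * p ≤ q) :
    p * ENNReal.ofReal (d ^ 2 / 8) ≤
      p * rankRisk v φ fhat e π k + q * rankRisk v φ fhat e (Equiv.swap k l * π) l := by
  have hdist : ‖meanVector φ (e ∘ π) - meanVector φ (e ∘ (Equiv.swap k l * π : Equiv.Perm (Fin n)))‖ ^ 2 ≤ D := by
    rw [norm_sq_meanVector_sub]
    refine le_trans (le_of_eq ?_) hD
    simp only [Function.comp_apply]
    rw [sum_sq_sub_comp_swap hkl]; ring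
  have hsymm : (Equiv.swap k l * π).symm l = π.symm k := by
    rw [Equiv.symm_apply_eq]; simp
  have := two_point_lower_bound hv _ _ hdist
    (h := fun y => inner ℝ (φ (π.symm k)) (fhat y) / √(n : ℝ)) (by fun_prop) hd hde hpq
  rw [rankRisk, rankRisk, hsymm]
  exact this

/-- If the entries of `e` with index in `G` are separated from the much more numerous entries with
index in `L`, then the positions of the former cannot be found, for some permutation of `e`. -/
theorem exists_perm_le_risk (hv : v ≠ 0) (φ : OrthonormalBasis (Fin n) ℝ (Obs n))
    {fhat : Obs n → Obs n} (hf : Measurable fhat) (e : Fin n → ℝ) {G L : Finset (Fin n)}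
    (hGL : Disjoint G L) (hG : G.Nonempty) (hL : L.Nonempty) {d D : ℝ} (hd : 0 ≤ d)
    (hde : ∀ k ∈ G, ∀ l ∈ L, d ≤ |e k - e l|)
    (hD : ∀ k ∈ G, ∀ l ∈ L, 2 * n * (e k - e l) ^ 2 ≤ D)
    (hcard : shiftFactor v D * G.card ≤ L.card) :
    ∃ π : Equiv.Perm (Fin n),
      G.card * ENNReal.ofReal (d ^ 2 / 8) ≤ risk v fhat (meanVector φ (e ∘ π)) := by
  set A := rankRisk v φ fhat e with hA
  set c : ℝ≥0∞ := ENNReal.ofReal (d ^ 2 / 8)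
  have hswap : ∀ k ∈ G, ∀ l ∈ L, ∑ _π : Equiv.Perm (Fin n), (G.card : ℝ≥0∞) * c ≤
      ∑ π, (G.card * A π k + L.card * A π l) := by
    intro k hk l hl
    -- Left multiplication by the swap permutes all permutations, so the swapped risk can be
    -- replaced by the unswapped one under the sum.
    rw [Finset.sum_add_distrib, ← Equiv.sum_comp (Equiv.mulLeft (Equiv.swap k l))
      (fun π => (L.card : ℝ≥0∞) * A π l), ← Finset.sum_add_distrib]
    exact Finset.sum_le_sum fun π _ => rankRisk_swap_lower_bound hv φ hf e π
      (Finset.disjoint_iff_ne.1 hGL k hk l hl) hd (hde k hk l hl)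
      (hD k hk l hl) hcard
  have hsum : ∑ _π : Equiv.Perm (Fin n), (G.card * L.card : ℝ≥0∞) * (G.card * c) ≤
      ∑ π : Equiv.Perm (Fin n), (G.card * L.card : ℝ≥0∞) * risk v fhat (meanVector φ (e ∘ π)) := by
    calc ∑ _π : Equiv.Perm (Fin n), (G.card * L.card : ℝ≥0∞) * (G.card * c)
        = ∑ _k ∈ G, ∑ _l ∈ L, ∑ _π : Equiv.Perm (Fin n), (G.card : ℝ≥0∞) * c := by
          simp only [Finset.sum_const, nsmul_eq_mul]; ring
      _ ≤ ∑ k ∈ G, ∑ l ∈ L, ∑ π, (G.card * A π k + L.card * A π l) :=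
          Finset.sum_le_sum fun k hk => Finset.sum_le_sum fun l hl => hswap k hk l hl
      _ = ∑ π, (G.card * L.card : ℝ≥0∞) * (∑ k ∈ G, A π k + ∑ l ∈ L, A π l) := by
          simp_rw [fun k => Finset.sum_comm (s := L) (t := Finset.univ)
            (f := fun l π => (G.card * A π k + L.card * A π l))]
          rw [Finset.sum_comm]
          refine Finset.sum_congr rfl fun π _ => ?_
          simp only [Finset.sum_add_distrib, Finset.sum_const, nsmul_eq_mul, ← Finset.mul_sum]
          ring
      _ ≤ _ := by
          gcongr with π
          rw [risk_meanVector_eq_sum φ hf, ← Finset.sum_union hGL]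
          exact Finset.sum_le_sum_of_subset (Finset.subset_univ _)
  obtain ⟨π, hπ⟩ := Finite.exists_max fun π : Equiv.Perm (Fin n) =>
    risk v fhat (meanVector φ (e ∘ π))
  have hle := hsum.trans (Finset.sum_le_sum fun ρ _ => mul_le_mul_right (hπ ρ) _)
  rw [Finset.sum_const, Finset.sum_const, nsmul_eq_mul, nsmul_eq_mul,
    ← mul_assoc (Finset.card _ : ℝ≥0∞), ← mul_assoc (Finset.card _ : ℝ≥0∞) _ (risk _ _ _)] at hle
  refine ⟨π, (ENNReal.mul_le_mul_iff_right ?_ ?_).1 hle⟩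
  · simp [hG.ne_empty, hL.ne_empty]
  · exact ENNReal.mul_ne_top (ENNReal.natCast_ne_top _)
      (ENNReal.mul_ne_top (ENNReal.natCast_ne_top _) (ENNReal.natCast_ne_top _))

/-! ### Polynomially decaying coefficients -/

variable {α : ℝ}

theorem polyDecay_sq (α : ℝ) (j : Fin n) : polyDecay n α j ^ 2 = ((j : ℕ) + 1 : ℝ) ^ (-(2 * α)) := by
  rw [polyDecay, ← Real.rpow_natCast, ← Real.rpow_mul (by positivity)]
  congr 1; push_cast; ring

theorem sum_Ico_rpow_le (hα : 1 / 2 < α) {M : ℕ} (hM : 0 < M) (n : ℕ) :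
    ∑ i ∈ Finset.Ico M n, ((i : ℝ) + 1) ^ (-(2 * α)) ≤ (M : ℝ) ^ (1 - 2 * α) / (2 * α - 1) := by
  have hα' : 0 < 2 * α - 1 := by linarith
  have hM' : (0 : ℝ) < M := by exact_mod_cast hM
  rcases le_total n M with h | h
  · rw [Finset.Ico_eq_empty_of_le h, Finset.sum_empty]; positivity
  have hanti : AntitoneOn (fun x : ℝ => x ^ (-(2 * α))) (Set.Icc (M : ℝ) n) := by
    intro x hx y _ hxy
    exact Real.rpow_le_rpow_of_nonpos (hM'.trans_le hx.1) hxy (by linarith)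
  have h1 := hanti.sum_le_integral_Ico h
  push_cast at h1
  refine h1.trans ?_
  have hn' : (0 : ℝ) < n := hM'.trans_le (by exact_mod_cast h)
  rw [integral_rpow (Or.inr ⟨by linarith, fun h0 => by
    rw [Set.uIcc_of_le (by exact_mod_cast h)] at h0; exact absurd h0.1 (not_le.2 hM')⟩)]
  rw [show -(2 * α) + 1 = -(2 * α - 1) by ring, show 1 - 2 * α = -(2 * α - 1) by ring,
    div_neg, ← neg_div]
  gcongr
  have := Real.rpow_pos_of_pos hn' (-(2 * α - 1))
  linarith

theorem rpow_one_div_rpow (hα : 1 / 2 < α) {x : ℝ} (hx : 0 < x) :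
    (x ^ (1 / (2 * α))) ^ (1 - 2 * α) = x ^ (1 / (2 * α) - 1) := by
  rw [← Real.rpow_mul hx.le]
  congr 1
  have : α ≠ 0 := by linarith
  field_simp

/-- The ideal model averaging risk is at most of the order `n ^ (1 / (2 α) - 1)`. -/
theorem idealMARisk_polyDecay_le (hα : 1 / 2 < α) (hn : 0 < n)
    (φ : OrthonormalBasis (Fin n) ℝ (Obs n)) (π : Equiv.Perm (Fin n)) :
    idealMARisk v φ (meanVector φ (polyDecay n α ∘ π)) ≤
      ENNReal.ofReal ((2 * v + 1 / (2 * α - 1)) * (n : ℝ) ^ (1 / (2 * α) - 1)) := by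
  have hα' : 0 < 2 * α - 1 := by linarith
  have hn' : (0 : ℝ) < n := by exact_mod_cast hn
  -- The cutoff `x` balances variance `x / n` against the squared bias, of order `x ^ (1 - 2α)`.
  set x : ℝ := (n : ℝ) ^ (1 / (2 * α)) with hx
  have hx1 : 1 ≤ x := Real.one_le_rpow (by exact_mod_cast hn) (by positivity)
  set M := ⌈x⌉₊ with hM
  have hMx : x ≤ M := Nat.le_ceil x
  have hM2 : (M : ℝ) ≤ 2 * x := by
    have := (Nat.ceil_lt_add_one (zero_le_one.trans hx1)).le
    linarith
  have hM0 : 0 < M := Nat.ceil_pos.2 (by linarith)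
  have hxn : x / n = (n : ℝ) ^ (1 / (2 * α) - 1) := by rw [Real.rpow_sub_one hn'.ne']
  set I : Finset (Fin n) := Finset.univ.filter fun j => (π j : ℕ) < M with hI
  refine (idealMARisk_le φ _ I).trans (ENNReal.ofReal_le_ofReal ?_)
  rw [add_mul]
  have hIcard : I.card ≤ M := by
    rw [← Finset.card_range M]
    refine Finset.card_le_card_of_injOn (fun j => (π j : ℕ)) (fun j hj => ?_) ?_
    · simpa [hI] using hj
    · intro i _ j _ hij
      exact π.injective (Fin.ext hij)
  refine add_le_add ?_ ?_
  · calc (I.card : ℝ) * v / n ≤ (2 * x) * v / n := by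
          gcongr
          exact le_trans (by exact_mod_cast hIcard) hM2
      _ = 2 * v * (x / n) := by ring
      _ = _ := by rw [hxn]
  · calc ∑ j ∈ Iᶜ, coeff φ (meanVector φ (polyDecay n α ∘ π)) j ^ 2
        = ∑ j ∈ Iᶜ, (((π j : ℕ) : ℝ) + 1) ^ (-(2 * α)) := by
          refine Finset.sum_congr rfl fun j _ => ?_
          rw [coeff_meanVector, Function.comp_apply, polyDecay_sq]
      _ = ∑ i ∈ Iᶜ.image (fun j => (π j : ℕ)), ((i : ℝ) + 1) ^ (-(2 * α)) := by
          rw [Finset.sum_image]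
          intro i _ j _ hij
          exact π.injective (Fin.ext hij)
      _ ≤ ∑ i ∈ Finset.Ico M n, ((i : ℝ) + 1) ^ (-(2 * α)) := by
          refine Finset.sum_le_sum_of_subset_of_nonneg ?_ fun i _ _ => by positivity
          intro i hi
          obtain ⟨j, hj, rfl⟩ := Finset.mem_image.1 hi
          simpa [hI] using hj
      _ ≤ (M : ℝ) ^ (1 - 2 * α) / (2 * α - 1) := sum_Ico_rpow_le hα hM0 n
      _ ≤ x ^ (1 - 2 * α) / (2 * α - 1) := by
          gcongr ?_ / _
          exact Real.rpow_le_rpow_of_nonpos (by linarith) hMx (by linarith)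
      _ = _ := by rw [hx, rpow_one_div_rpow hα hn']; ring

theorem card_filter_Ico_val {n a b : ℕ} (hb : b ≤ n) :
    (Finset.univ.filter fun i : Fin n => a ≤ (i : ℕ) ∧ (i : ℕ) < b).card = b - a := by
  have h : (Finset.univ.filter fun i : Fin n => a ≤ (i : ℕ) ∧ (i : ℕ) < b).map Fin.valEmbedding =
      Finset.Ico a b := by
    ext i
    simp only [Finset.mem_map, Finset.mem_filter, Finset.mem_univ, true_and, Finset.mem_Ico,
      Fin.valEmbedding_apply]
    exact ⟨by rintro ⟨j, hj, rfl⟩; exact hj, fun hi => ⟨⟨i, hi.2.trans_le hb⟩, hi, rfl⟩⟩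
  rw [← Finset.card_map, h, Nat.card_Ico]

/-- The worst case risk over all permutations is of larger order than `n ^ (1 / (2 α) - 1)`:
the bound for a group of about `ε n ^ (1 / (2 α))` coefficients of size of the noise level. -/
theorem exists_perm_polyDecay_le_risk (hv : v ≠ 0) (hα : 1 / 2 < α) (hn : 0 < n)
    (φ : OrthonormalBasis (Fin n) ℝ (Obs n)) {fhat : Obs n → Obs n} (hf : Measurable fhat)
    {ε : ℝ} (hε : 0 < ε) (h1 : 1 ≤ ε * (n : ℝ) ^ (1 / (2 * α)))
    (h2 : (32 + 4 * shiftFactor v (2 * ε ^ (-(2 * α)))) * (ε * (n : ℝ) ^ (1 / (2 * α))) ≤ n) :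
    ∃ π : Equiv.Perm (Fin n),
      ENNReal.ofReal ((4 * ε) ^ (1 - 2 * α) / 64 * (n : ℝ) ^ (1 / (2 * α) - 1)) ≤
        risk v fhat (meanVector φ (polyDecay n α ∘ π)) := by
  have hα0 : 0 < α := by linarith
  have hn' : (0 : ℝ) < n := by exact_mod_cast hn
  set x : ℝ := (n : ℝ) ^ (1 / (2 * α)) with hx
  have hx0 : 0 < x := Real.rpow_pos_of_pos hn' _
  set D : ℝ := 2 * ε ^ (-(2 * α)) with hD
  set T := shiftFactor v D with hT
  have hT0 : 0 < T := shiftFactor_pos D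
  set m := ⌈ε * x⌉₊ with hm
  have hmx : ε * x ≤ m := Nat.le_ceil _
  have hm2 : (m : ℝ) ≤ 2 * (ε * x) := by
    have := (Nat.ceil_lt_add_one (zero_le_one.trans h1)).le
    linarith
  have hm1 : (1 : ℝ) ≤ m := h1.trans hmx
  have hm0 : 0 < m := by exact_mod_cast (zero_lt_one.trans_le hm1)
  have hTx : 0 ≤ T * (ε * x) := by positivity
  -- The constant 32 in `h2` gives `16 * m ≤ n`, so 1-based ranks in `L` are at least four times
  -- those in `G`; the summand with factor 4 gives `T * m ≤ n / 2`.
  have hmn : 16 * m ≤ n := by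
    have : (16 * m : ℝ) ≤ n := by nlinarith
    exact_mod_cast this
  set G : Finset (Fin n) := Finset.univ.filter fun i => m ≤ (i : ℕ) ∧ (i : ℕ) < 2 * m with hG
  set L : Finset (Fin n) := Finset.univ.filter fun i => n / 2 ≤ (i : ℕ) ∧ (i : ℕ) < n with hL
  have hGc : G.card = m := by rw [hG, card_filter_Ico_val (by omega)]; omega
  have hLc : L.card = n - n / 2 := card_filter_Ico_val le_rfl
  have hLc' : (n : ℝ) / 2 ≤ L.card := by
    have : n ≤ 2 * L.card := by omega
    have : (n : ℝ) ≤ 2 * L.card := by exact_mod_cast this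
    linarith
  have hdis : Disjoint G L := by
    rw [Finset.disjoint_left]
    intro i hi hj
    simp only [hG, hL, Finset.mem_filter] at hi hj
    omega
  have hval : ∀ k ∈ G, ∀ l ∈ L, polyDecay n α l ≤ polyDecay n α k / 2 := by
    intro k hk l hl
    simp only [hG, hL, Finset.mem_filter, Finset.mem_univ, true_and] at hk hl
    have hkl : 4 * ((k : ℕ) + 1) ≤ (l : ℕ) + 1 := by omega
    have hkl' : (4 : ℝ) * (((k : ℕ) : ℝ) + 1) ≤ ((l : ℕ) : ℝ) + 1 := by exact_mod_cast hkl
    -- As `α > 1/2`, a fourfold rank at least halves the entry; hence the gap `d` is half the lower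
    -- bound for entries of `G`.
    have h4 : (4 : ℝ) ^ (-α) ≤ 1 / 2 := by
      have : (4 : ℝ) ^ (-α) ≤ 4 ^ (-(1 / 2 : ℝ)) :=
        Real.rpow_le_rpow_of_exponent_le (by norm_num) (by linarith)
      refine this.trans (le_of_eq ?_)
      rw [Real.rpow_neg (by norm_num), ← Real.sqrt_eq_rpow,
        show (4 : ℝ) = 2 ^ 2 by norm_num, Real.sqrt_sq (by norm_num)]
      norm_num
    calc polyDecay n α l ≤ (4 * (((k : ℕ) : ℝ) + 1)) ^ (-α) :=
          Real.rpow_le_rpow_of_nonpos (by positivity) hkl' (by linarith)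
      _ = 4 ^ (-α) * polyDecay n α k := by
          rw [polyDecay, Real.mul_rpow (by norm_num) (by positivity)]
      _ ≤ 1 / 2 * polyDecay n α k := by
          gcongr
          rw [polyDecay]; positivity
      _ = _ := by ring
  have hpos : ∀ i, 0 < polyDecay n α i := fun i => by rw [polyDecay]; positivity
  have hGlow : ∀ k ∈ G, (2 * m : ℝ) ^ (-α) ≤ polyDecay n α k := by
    intro k hk
    simp only [hG, Finset.mem_filter, Finset.mem_univ, true_and] at hk
    refine Real.rpow_le_rpow_of_nonpos (by positivity) ?_ (by linarith)
    have : (k : ℕ) + 1 ≤ 2 * m := by omega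
    exact_mod_cast this
  have hGup : ∀ k ∈ G, 2 * n * polyDecay n α k ^ 2 ≤ D := by
    intro k hk
    simp only [hG, Finset.mem_filter, Finset.mem_univ, true_and] at hk
    have hk' : (m : ℝ) ≤ ((k : ℕ) : ℝ) + 1 := by
      have : m ≤ (k : ℕ) + 1 := by omega
      exact_mod_cast this
    have hxn : x ^ (-(2 * α)) = (n : ℝ)⁻¹ := by
      rw [hx, ← Real.rpow_mul hn'.le, ← Real.rpow_neg_one]
      congr 1; field_simp
    calc 2 * n * polyDecay n α k ^ 2 ≤ 2 * n * (ε * x) ^ (-(2 * α)) := by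
          rw [polyDecay_sq]
          gcongr 2 * n * ?_
          exact Real.rpow_le_rpow_of_nonpos (by positivity) (hmx.trans hk') (by linarith)
      _ = D := by
          rw [Real.mul_rpow hε.le hx0.le, hxn, hD]
          field_simp
  obtain ⟨π, hπ⟩ := exists_perm_le_risk hv φ hf (polyDecay n α) hdis
    (Finset.card_pos.1 (by omega)) (Finset.card_pos.1 (by omega))
    (d := (2 * m : ℝ) ^ (-α) / 2) (D := D) (by positivity)
    (fun k hk l hl => by
      have h3 := hval k hk l hl
      have h4 := hGlow k hk
      refine le_trans ?_ (le_abs_self _)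
      linarith)
    (fun k hk l hl => by
      refine le_trans ?_ (hGup k hk)
      have h3 := hval k hk l hl
      have h4 := hpos k
      have h5 := hpos l
      gcongr
      · linarith
      · linarith)
    (by
      rw [hGc]
      refine le_trans ?_ hLc'
      have : T * m ≤ T * (2 * (ε * x)) := by gcongr
      nlinarith)
  refine ⟨π, le_trans ?_ hπ⟩
  rw [hGc, ← ENNReal.ofReal_natCast, ← ENNReal.ofReal_mul (by positivity)]
  apply ENNReal.ofReal_le_ofReal
  have h2m : (0 : ℝ) < 2 * m := by positivity
  calc (4 * ε) ^ (1 - 2 * α) / 64 * (n : ℝ) ^ (1 / (2 * α) - 1)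
      = (4 * ε * x) ^ (1 - 2 * α) / 64 := by
        rw [Real.mul_rpow (by positivity) hx0.le, hx, rpow_one_div_rpow hα hn']; ring
    _ ≤ (2 * m : ℝ) ^ (1 - 2 * α) / 64 := by
        gcongr ?_ / _
        exact Real.rpow_le_rpow_of_nonpos h2m (by linarith) (by linarith)
    _ = m * (((2 * m : ℝ) ^ (-α) / 2) ^ 2 / 8) := by
        rw [show 1 - 2 * α = 1 + (-α + -α) by ring, Real.rpow_add h2m, Real.rpow_one,
          Real.rpow_add h2m]
        ring

theorem eventually_exists_perm_le_risk (hv : v ≠ 0) (hα : 1 / 2 < α)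
    (φ : ∀ n : ℕ, OrthonormalBasis (Fin n) ℝ (Obs n)) {fhat : ∀ n : ℕ, Obs n → Obs n}
    (hf : ∀ n, Measurable (fhat n)) (K : ℝ) :
    ∀ᶠ n : ℕ in atTop, ∃ π : Equiv.Perm (Fin n),
      ENNReal.ofReal (K * (n : ℝ) ^ (1 / (2 * α) - 1)) ≤
        risk v (fhat n) (meanVector (φ n) (polyDecay n α ∘ π)) := by
  have hα0 : 0 < α := by linarith
  obtain ⟨ε, hε, hK⟩ : ∃ ε : ℝ, 0 < ε ∧ K ≤ (4 * ε) ^ (1 - 2 * α) / 64 := by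
    have h := (tendsto_rpow_neg_nhdsGT_zero (y := 1 - 2 * α) (by linarith)).eventually_ge_atTop
      (64 * K)
    obtain ⟨δ, hδ, hδ0⟩ := (h.and self_mem_nhdsWithin).exists
    refine ⟨δ / 4, div_pos hδ0 (by norm_num), ?_⟩
    rw [mul_div_cancel₀ _ (by norm_num)]
    linarith
  set B := (32 + 4 * shiftFactor v (2 * ε ^ (-(2 * α)))) * ε with hB
  -- Both size conditions hold eventually: `n ^ (1/(2α))` tends to infinity but is `o(n)`, because
  -- `2α > 1`.
  have hpow : Tendsto (fun n : ℕ => ε * (n : ℝ) ^ (1 / (2 * α))) atTop atTop :=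
    ((tendsto_rpow_atTop (by positivity)).comp tendsto_natCast_atTop_atTop).const_mul_atTop hε
  have hβ : 0 < 1 - 1 / (2 * α) := by
    rw [sub_pos, div_lt_one (by positivity)]; linarith
  have hpow' : Tendsto (fun n : ℕ => (n : ℝ) ^ (1 - 1 / (2 * α))) atTop atTop :=
    (tendsto_rpow_atTop hβ).comp tendsto_natCast_atTop_atTop
  filter_upwards [hpow.eventually_ge_atTop 1, hpow'.eventually_ge_atTop B, eventually_gt_atTop 0]
    with n h1 h2 hn
  have hn' : (0 : ℝ) < n := by exact_mod_cast hn
  obtain ⟨π, hπ⟩ := exists_perm_polyDecay_le_risk hv hα hn (φ n) (hf n) hε h1 (by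
    rw [← mul_assoc, ← hB]
    calc B * (n : ℝ) ^ (1 / (2 * α)) ≤
          (n : ℝ) ^ (1 - 1 / (2 * α)) * (n : ℝ) ^ (1 / (2 * α)) := by gcongr
      _ = n := by rw [← Real.rpow_add hn', sub_add_cancel, Real.rpow_one])
  refine ⟨π, le_trans (ENNReal.ofReal_le_ofReal ?_) hπ⟩
  gcongr

theorem isBoundedUnder_norm_sq_meanVector_polyDecay (hα : 1 / 2 < α)
    (φ : ∀ n : ℕ, OrthonormalBasis (Fin n) ℝ (Obs n)) (π : ∀ n : ℕ, Equiv.Perm (Fin n)) :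
    IsBoundedUnder (· ≤ ·) atTop
      (fun n : ℕ => ‖meanVector (φ n) (polyDecay n α ∘ π n)‖ ^ 2 / (n : ℝ)) := by
  have hs : Summable (fun i : ℕ => ((i : ℝ) + 1) ^ (-(2 * α))) := by
    have := (summable_nat_add_iff 1).2 (Real.summable_nat_rpow.2 (show -(2 * α) < -1 by linarith))
    simpa using this
  refine isBoundedUnder_of_eventually_le (a := ∑' i : ℕ, ((i : ℝ) + 1) ^ (-(2 * α))) ?_
  filter_upwards [eventually_gt_atTop 0] with n hn
  have hn' : (n : ℝ) ≠ 0 := by exact_mod_cast hn.ne'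
  rw [norm_sq_meanVector, mul_div_cancel_left₀ _ hn']
  simp only [Function.comp_apply]
  rw [Equiv.sum_comp (π n) (fun i => polyDecay n α i ^ 2)]
  simp_rw [polyDecay_sq]
  rw [Fin.sum_univ_eq_sum_range (fun i : ℕ => ((i : ℝ) + 1) ^ (-(2 * α)))]
  exact hs.sum_le_tsum _ fun i _ => by positivity

end ModelAveraging


/-! ### Conclusion -/

theorem theorem7 (v : ℝ≥0) (hv : 0 < v) (α : ℝ) (hα : 1 / 2 < α)
    (φ : ∀ n : ℕ, OrthonormalBasis (Fin n) ℝ (ModelAveraging.Obs n))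
    (fhat : ∀ n : ℕ, ModelAveraging.Obs n → ModelAveraging.Obs n)
    (hfhat : ∀ n, Measurable (fhat n)) :
    ∃ f : ∀ n : ℕ, ModelAveraging.Obs n,
      (∀ n, ModelAveraging.coeff (φ n) (f n) ∈
        ModelAveraging.rearrangements (ModelAveraging.polyDecay n α)) ∧
      IsBoundedUnder (· ≤ ·) atTop (fun n : ℕ => ‖f n‖ ^ 2 / (n : ℝ)) ∧
      Tendsto (fun n : ℕ => ModelAveraging.risk v (fhat n) (f n) /
        ModelAveraging.idealMARisk v (φ n) (f n)) atTop (𝓝 ⊤) ∧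
      ¬ ModelAveraging.AchievesIdealAOP v φ fhat f := by
  open ModelAveraging in
  have hα' : 0 < 2 * α - 1 := by linarith
  -- Taking a worst permutation for each `n` makes one sequence serve every constant `K`, although
  -- the permutation from the lower bound depends on `K`.
  choose π hπ using fun n => Finite.exists_max fun π : Equiv.Perm (Fin n) =>
    risk v (fhat n) (meanVector (φ n) (polyDecay n α ∘ π))
  set f : ∀ n : ℕ, Obs n := fun n => meanVector (φ n) (polyDecay n α ∘ π n) with hf
  set U : ℕ → ℝ≥0∞ := fun n =>
    ENNReal.ofReal ((2 * v + 1 / (2 * α - 1)) * (n : ℝ) ^ (1 / (2 * α) - 1)) with hU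
  have hideal : ∀ᶠ n in atTop, idealMARisk v (φ n) (f n) ≤ U n := by
    filter_upwards [eventually_gt_atTop 0] with n hn
    exact idealMARisk_polyDecay_le hα hn (φ n) (π n)
  have hU0 : ∀ᶠ n in atTop, U n ≠ 0 := by
    filter_upwards [eventually_gt_atTop 0] with n hn
    have : (0 : ℝ) < n := by exact_mod_cast hn
    exact (ENNReal.ofReal_pos.2 (by positivity)).ne'
  have hrisk : ∀ K : ℝ≥0, ∀ᶠ n in atTop, K * U n ≤ risk v (fhat n) (f n) := by
    intro K
    filter_upwards [eventually_exists_perm_le_risk hv.ne' hα φ hfhat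
      (K * (2 * v + 1 / (2 * α - 1)))] with n hn
    obtain ⟨ρ, hρ⟩ := hn
    refine le_trans (le_of_eq ?_) (hρ.trans (hπ n ρ))
    rw [mul_assoc, ENNReal.ofReal_mul K.coe_nonneg, ENNReal.ofReal_coe_nnreal]
  refine ⟨f, fun n => ⟨π n, fun j => coeff_meanVector _ _ j⟩,
    isBoundedUnder_norm_sq_meanVector_polyDecay hα φ π, ?_, ?_⟩
  · rw [ENNReal.tendsto_nhds_top_iff_nnreal]
    intro K
    filter_upwards [hideal, hU0, hrisk (K + 1)] with n h1 h2 h3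
    -- A nonzero risk excludes the quotient `0 / 0 = 0`, in case the ideal risk vanishes.
    have hr0 : risk v (fhat n) (f n) ≠ 0 := fun h => by
      rw [h, nonpos_iff_eq_zero, mul_eq_zero] at h3
      simp [h2] at h3
    have hlt : (K : ℝ≥0∞) < ((K + 1 : ℝ≥0) : ℝ≥0∞) := by exact_mod_cast lt_add_one K
    refine hlt.trans_le ((ENNReal.le_div_iff_mul_le (Or.inr hr0)
      (Or.inl (h1.trans_lt ENNReal.ofReal_lt_top).ne)).2 (le_trans ?_ h3))
    gcongr
  · rintro ⟨δ, hδ, hle⟩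
    have hδ1 : ∀ᶠ n in atTop, δ n ≤ 1 := hδ.eventually_le_const zero_lt_one
    -- Any constant above 2 would do: eventually `1 + δ n ≤ 2`.
    obtain ⟨n, h1, h2, h3, h4, h5⟩ :=
      (hideal.and (hU0.and ((hrisk 3).and (hδ1.and hle)))).exists
    have h6 : (3 : ℝ≥0∞) * U n ≤ 2 * U n := by
      calc (3 : ℝ≥0∞) * U n ≤ risk v (fhat n) (f n) := by exact_mod_cast h3
        _ ≤ (1 + δ n) * idealMARisk v (φ n) (f n) := h5
        _ ≤ (1 + 1) * U n := by gcongr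
        _ = 2 * U n := by rw [one_add_one_eq_two]
    rw [ENNReal.mul_le_mul_iff_left h2 ENNReal.ofReal_ne_top] at h6
    norm_num at h6
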